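/- Fix $n\in\mathbb N$ and $1<p<\infty$. For $x\in\mathbb R^n$, $t\in\mathbb R$, $L>0$ let $Q(x,L)=\{y\in\mathbb R^n: |y_i-x_i|\le L,\ i=1,\dots,n\}$. A parabolic rectangle is a set $R=R(x,t,L)=Q(x,L)\times(t-L^p,t+L^p)\subset\mathbb R^{n+1}$; for $0\le\gamma<1$ its upper and lower parts are $$R^+(\gamma)=Q(x,L)\times(t+\gamma L^p,t+L^p),\qquad R^-(\gamma)=Q(x,L)\times(t-L^p,t-\gamma L^p),$$ and $R^\pm=R^\pm(0)$. A weight is a nonnegative locally integrable function on $\mathbb R^{n+1}$, and $|A|$ denotes Lebesgue measure. For $1<q<\infty$, a weight $w$ belongs to $A_q^+(\gamma)$ if $$\sup_{R}\Bigl(\frac1{|R^-(\gamma)|}\int_{R^-(\gamma)} w\Bigr)\Bigl(\frac1{|R^+(\gamma)|}\int_{R^+(\gamma)} w^{\frac1{1-q}}\Bigr)^{q-1}<\infty,$$ the supremum being over all parabolic rectangles $R\subset\mathbb R^{n+1}$ (with values in $[0,\infty]$ and $0\cdot\infty=0$); $w$ belongs to $A_1^+(\gamma)$ if there is a constant $C>0$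 with $\frac1{|R^-(\gamma)|}\int_{R^-(\gamma)} w\le C\,\operatorname{ess\,inf}_{R^+(\gamma)} w$ for every parabolic rectangle $R$. Theorem. Let $1\le q<\infty$, $0<\gamma<1$ and $w\in A_q^+(\gamma)$. Then there exist $\varepsilon>0$ and $c>0$ such that $$\Bigl(\frac1{|R^-|}\int_{R^-} w^{1+\varepsilon}\Bigr)^{\frac1{1+\varepsilon}}\le c\,\frac1{|R^+|}\int_{R^+} w$$ for every parabolic rectangle $R\subset\mathbb R^{n+1}$. (In particular, $w^{1+\varepsilon}$ is integrable over every $R^-$.) -/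

import Mathlib

open MeasureTheory
open scoped ENNReal

noncomputable section

/-- Space-time `ℝⁿ × ℝ`, with points `(x, t)`; its canonical `volume` is Lebesgue measure. -/
abbrev SpaceTime (n : ℕ) : Type := (Fin n → ℝ) × ℝ

/-- The closed cube `Q(x, L) = {y : |y i - x i| ≤ L for all i}`. -/
def spaceCube {n : ℕ} (x : Fin n → ℝ) (L : ℝ) : Set (Fin n → ℝ) :=
  {y | ∀ i, |y i - x i| ≤ L}

/-- The upper part `R⁺(γ) = Q(x, L) × (t + γ L^p, t + L^p)` of the parabolic rectangle
`R(x, t, L) = Q(x, L) × (t - L^p, t + L^p)`. -/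
def rectUpper {n : ℕ} (p γ : ℝ) (x : Fin n → ℝ) (t L : ℝ) : Set (SpaceTime n) :=
  spaceCube x L ×ˢ Set.Ioo (t + γ * L ^ p) (t + L ^ p)

/-- The lower part `R⁻(γ) = Q(x, L) × (t - L^p, t - γ L^p)` of the parabolic rectangle
`R(x, t, L) = Q(x, L) × (t - L^p, t + L^p)`. -/
def rectLower {n : ℕ} (p γ : ℝ) (x : Fin n → ℝ) (t L : ℝ) : Set (SpaceTime n) :=
  spaceCube x L ×ˢ Set.Ioo (t - L ^ p) (t - γ * L ^ p)

/-- A weight is a nonnegative locally integrable function on space-time. -/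
structure IsWeight {n : ℕ} (w : SpaceTime n → ℝ) : Prop where
  nonneg : ∀ z, 0 ≤ w z
  locallyIntegrable : LocallyIntegrable w volume

/-- The constant `[w]_{A_q⁺(γ)}` for `1 < q < ∞`, the supremum over all parabolic rectangles `R` of
`(⨍_{R⁻(γ)} w) (⨍_{R⁺(γ)} w^{1/(1-q)})^{q-1}`, computed in `[0, ∞]`
(so that `0 ^ (1/(1-q)) = ∞`, and `0 * ∞ = 0`). -/
def aqConst {n : ℕ} (p q γ : ℝ) (w : SpaceTime n → ℝ) : ℝ≥0∞ :=
  ⨆ (x : Fin n → ℝ) (t : ℝ) (L : ℝ) (_ : 0 < L),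
    (⨍⁻ z in rectLower p γ x t L, ENNReal.ofReal (w z) ∂volume) *
      (⨍⁻ z in rectUpper p γ x t L, ENNReal.ofReal (w z) ^ (1 / (1 - q)) ∂volume) ^ (q - 1)

/-- The `A_1⁺(γ)` condition with constant `C`: `⨍_{R⁻(γ)} w ≤ C ess inf_{R⁺(γ)} w` for every
parabolic rectangle `R`. -/
def A1Bound {n : ℕ} (p γ : ℝ) (w : SpaceTime n → ℝ) (C : ℝ) : Prop :=
  ∀ (x : Fin n → ℝ) (t L : ℝ), 0 < L →
    ⨍⁻ z in rectLower p γ x t L, ENNReal.ofReal (w z) ∂volume ≤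
      ENNReal.ofReal C *
        essInf (fun z => ENNReal.ofReal (w z)) (volume.restrict (rectUpper p γ x t L))

/-- The weight `w` belongs to the parabolic Muckenhoupt class `A_q⁺(γ)`, `1 ≤ q < ∞`. -/
def MemParabolicA {n : ℕ} (p q γ : ℝ) (w : SpaceTime n → ℝ) : Prop :=
  IsWeight w ∧
    ((1 < q ∧ aqConst p q γ w < ∞) ∨ (q = 1 ∧ ∃ C : ℝ, 0 < C ∧ A1Bound p γ w C))

end

open Metric Set Filter Topology

/-- `μ` gives every closed ball of radius `r > 0` the mass `c * r ^ D`. -/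
def HasBallMeasure {X : Type*} [MetricSpace X] [MeasurableSpace X] (μ : Measure X) (c D : ℝ) :
    Prop :=
  ∀ (x : X) (r : ℝ), 0 < r → μ (closedBall x r) = ENNReal.ofReal (c * r ^ D)

/-- Whenever the average of `w` over a ball exceeds `lam`, the function `w` exceeds `β * lam` on
a fixed proportion (in terms of the measure of the ball) of the `K` times enlarged ball. -/
def HasDenseSuperlevels {X : Type*} [MetricSpace X] [MeasurableSpace X] (μ : Measure X)
    (w : X → ℝ) (K η β : ℝ) : Prop :=
  ∀ (z : X) (r lam : ℝ), 0 < r → 0 < lam →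
    ENNReal.ofReal lam * μ (closedBall z r) < ∫⁻ y in closedBall z r, ENNReal.ofReal (w y) ∂μ →
    ENNReal.ofReal η * μ (closedBall z r) ≤ μ (closedBall z (K * r) ∩ {y | β * lam < w y})

section Metric

variable {X : Type*} [MetricSpace X] [MeasurableSpace X] {μ : Measure X} {c D : ℝ}

theorem HasBallMeasure.isUnifLocDoublingMeasure (hμ : HasBallMeasure μ c D) :
    IsUnifLocDoublingMeasure μ := by
  refine ⟨⟨Real.toNNReal (2 ^ D), ?_⟩⟩
  filter_upwards [self_mem_nhdsWithin] with r hr x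
  have hr : 0 < r := hr
  change _ ≤ ENNReal.ofReal (2 ^ D) * _
  rw [hμ x r hr, hμ x (2 * r) (by positivity), ← ENNReal.ofReal_mul (by positivity), Real.mul_rpow (by norm_num) hr.le]
  exact le_of_eq (by congr 1; ring)

theorem HasBallMeasure.isLocallyFiniteMeasure (hμ : HasBallMeasure μ c D) :
    IsLocallyFiniteMeasure μ :=
  ⟨fun x => ⟨closedBall x 1, closedBall_mem_nhds x one_pos, by
    rw [hμ x 1 one_pos]; exact ENNReal.ofReal_lt_top⟩⟩

theorem HasBallMeasure.measure_mul (hμ : HasBallMeasure μ c D) (x : X) {a r : ℝ} (ha : 0 < a)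
    (hr : 0 < r) :
    μ (closedBall x (a * r)) = ENNReal.ofReal (a ^ D) * μ (closedBall x r) := by
  rw [hμ x r hr, hμ x _ (by positivity), ← ENNReal.ofReal_mul (by positivity),
    Real.mul_rpow ha.le hr.le]
  congr 1; ring

variable [BorelSpace X] [SecondCountableTopology X]

theorem HasBallMeasure.ae_exists_small_ball (hμ : HasBallMeasure μ c D) (hc : 0 < c)
    {f : X → ℝ≥0∞} (hf : Measurable f) (hfin : ∫⁻ y, f y ∂μ ≠ ∞) :
    ∀ᵐ z ∂μ, ∀ lam < f z, ∀ δ > 0, ∃ r, 0 < r ∧ r < δ ∧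
      lam * μ (closedBall z r) < ∫⁻ y in closedBall z r, f y ∂μ := by
  have := hμ.isUnifLocDoublingMeasure
  have := hμ.isLocallyFiniteMeasure
  filter_upwards [(IsUnifLocDoublingMeasure.vitaliFamily μ 1).ae_tendsto_lintegral_div
    hf.aemeasurable hfin] with z hz lam hlam δ hδ
  have h1 := hz.comp (IsUnifLocDoublingMeasure.tendsto_closedBall_filterAt (K := 1) μ
    (l := 𝓝[>] (0 : ℝ)) (fun _ => z) (fun r => r) tendsto_id (by
      filter_upwards [self_mem_nhdsWithin] with r hr
      simpa using (le_of_lt hr : (0 : ℝ) ≤ r)))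
  have h2 := h1.eventually (lt_mem_nhds hlam)
  obtain ⟨r, hr, hrδ⟩ := (h2.and (Ioo_mem_nhdsGT hδ)).exists
  refine ⟨r, hrδ.1, hrδ.2, ?_⟩
  have hpos : 0 < c * r ^ D := mul_pos hc (Real.rpow_pos_of_pos hrδ.1 D)
  have hm := hμ z r hrδ.1
  simp only [Function.comp] at hr
  rwa [ENNReal.lt_div_iff_mul_lt] at hr
  · left; rw [hm]; exact (ENNReal.ofReal_pos.2 hpos).ne'
  · left; rw [hm]; exact ENNReal.ofReal_ne_top

/-- A level-set estimate: the mass of `w` on a superlevel set is controlled by the measure of a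
slightly lower superlevel set in a neighbourhood. -/
theorem HasBallMeasure.lintegral_superlevel_le (hμ : HasBallMeasure μ c D) (hc : 0 < c)
    {w : X → ℝ} (hw : Measurable w) {K η β : ℝ} (hK : 1 ≤ K) (hη : 0 < η)
    (hd : HasDenseSuperlevels μ w K η β) {U : Set X} {s lam : ℝ} (hs : 0 < s)
    (hfin : ∫⁻ y in thickening s U, ENNReal.ofReal (w y) ∂μ ≠ ∞) (hlam : 0 < lam)
    (havg : ∀ z ∈ U, ∀ r, s / (5 * K) ≤ r → r ≤ s →
      ∫⁻ y in closedBall z r, ENNReal.ofReal (w y) ∂μ ≤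
        ENNReal.ofReal lam * μ (closedBall z r)) :
    ∫⁻ y in U ∩ {y | lam < w y}, ENNReal.ofReal (w y) ∂μ ≤
      ENNReal.ofReal ((5 * K) ^ D / η * lam) * μ (thickening s U ∩ {y | β * lam < w y}) := by
  set f : X → ℝ≥0∞ := fun y => ENNReal.ofReal (w y) with hf_def
  have hf : Measurable f := hw.ennreal_ofReal
  have hT : MeasurableSet (thickening s U) := isOpen_thickening.measurableSet
  have hKpos : 0 < K := by linarith
  let big : X → Set ℝ := fun z =>
    {r | 0 < r ∧ r ≤ s ∧ ENNReal.ofReal lam * μ (closedBall z r) < ∫⁻ y in closedBall z r, f y ∂μ}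
  have hbig_lt : ∀ z ∈ U, ∀ r ∈ big z, r < s / (5 * K) := by
    intro z hz r hr
    by_contra! h
    exact absurd hr.2.2 (not_lt.2 (havg z hz r h hr.2.1))
  have hae : ∀ᵐ z ∂μ, z ∈ U → lam < w z → (big z).Nonempty := by
    have h1 := hμ.ae_exists_small_ball hc (f := (thickening s U).indicator f) (hf.indicator hT)
      (by rwa [lintegral_indicator hT])
    filter_upwards [h1] with z hz hzU hzl
    have hzT : z ∈ thickening s U := self_subset_thickening hs U hzU
    obtain ⟨r, hr0, hrs, hr⟩ := hz (ENNReal.ofReal lam) (by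
      rw [indicator_of_mem hzT]
      exact (ENNReal.ofReal_lt_ofReal_iff (hlam.trans hzl)).2 hzl) s hs
    refine ⟨r, hr0, hrs.le, hr.trans_le (lintegral_mono fun y => indicator_le_self _ _ _)⟩
  have hchoice : ∀ z, ∃ r, (big z).Nonempty → z ∈ U → r ∈ big z ∧ 5 * K * r ∉ big z := by
    intro z
    by_cases hz : (big z).Nonempty ∧ z ∈ U
    · have hbdd : BddAbove (big z) := ⟨s, fun r hr => hr.2.1⟩
      have hsup : 0 < sSup (big z) := by
        obtain ⟨r, hr⟩ := hz.1
        exact hr.1.trans_le (le_csSup hbdd hr)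
      obtain ⟨r, hr, hlt⟩ := exists_lt_of_lt_csSup hz.1 (half_lt_self hsup)
      refine ⟨r, fun _ _ => ⟨hr, fun h => ?_⟩⟩
      have := le_csSup hbdd h
      nlinarith [hr.1]
    · exact ⟨0, fun h1 h2 => absurd ⟨h1, h2⟩ hz⟩
  choose rad hrad using hchoice
  let G : Set X := {z | z ∈ U ∧ (big z).Nonempty}
  have hG : ∀ z ∈ G, 0 < rad z ∧ rad z < s / (5 * K) ∧
      ENNReal.ofReal lam * μ (closedBall z (rad z)) < ∫⁻ y in closedBall z (rad z), f y ∂μ ∧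
      ∫⁻ y in closedBall z (5 * K * rad z), f y ∂μ ≤
        ENNReal.ofReal lam * μ (closedBall z (5 * K * rad z)) := by
    intro z hz
    obtain ⟨h1, h2⟩ := hrad z hz.2 hz.1
    have h3 := hbig_lt z hz.1 _ h1
    refine ⟨h1.1, h3, h1.2.2, ?_⟩
    by_contra! h
    refine h2 ⟨by have := h1.1; positivity, ?_, h⟩
    rw [lt_div_iff₀ (by positivity)] at h3
    linarith
  obtain ⟨u, huG, hdisj, hcov⟩ := Vitali.exists_disjoint_subfamily_covering_enlargement_closedBall
    G (fun z => z) (fun z => K * rad z) s (by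
      intro z hz
      have h := (hG z hz).2.1
      rw [lt_div_iff₀ (by positivity)] at h
      have := (hG z hz).1
      nlinarith) 5 (by norm_num)
  have hKr : ∀ z ∈ G, 0 < K * rad z ∧ K * rad z < s := by
    intro z hz
    have h := (hG z hz).2.1
    rw [lt_div_iff₀ (by positivity)] at h
    have h0 := (hG z hz).1
    have : 0 < K * rad z := by positivity
    exact ⟨this, by nlinarith⟩
  have hcount : u.Countable := hdisj.countable_of_nonempty_interior fun z hz =>
    ⟨z, mem_interior_iff_mem_nhds.2 (closedBall_mem_nhds z (hKr z (huG hz)).1)⟩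
  have hsub : (U ∩ {y | lam < w y} : Set X) ≤ᵐ[μ] ⋃ z ∈ u, closedBall z (5 * K * rad z) := by
    filter_upwards [hae] with z hz hzU
    have hzG : z ∈ G := ⟨hzU.1, hz hzU.1 hzU.2⟩
    obtain ⟨b, hb, hzb⟩ := hcov z hzG
    refine mem_iUnion₂.2 ⟨b, hb, ?_⟩
    have := hzb (mem_closedBall_self (hKr z hzG).1.le)
    rwa [← mul_assoc] at this
  calc ∫⁻ y in U ∩ {y | lam < w y}, f y ∂μ
      ≤ ∫⁻ y in ⋃ z ∈ u, closedBall z (5 * K * rad z), f y ∂μ := lintegral_mono_set' hsub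
    _ ≤ ∑' z : u, ∫⁻ y in closedBall (z : X) (5 * K * rad z), f y ∂μ := by
        have := hcount.to_subtype
        rw [biUnion_eq_iUnion]
        exact lintegral_iUnion_le _ _
    _ ≤ ∑' z : u, ENNReal.ofReal ((5 * K) ^ D / η * lam) *
          μ (closedBall (z : X) (K * rad z) ∩ {y | β * lam < w y}) := by
        refine ENNReal.tsum_le_tsum fun z => ?_
        obtain ⟨h0, -, h1, h2⟩ := hG z (huG z.2)
        refine h2.trans ?_
        rw [hμ.measure_mul _ (by positivity) h0]
        have h3 := hd z (rad z) lam h0 hlam h1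
        calc ENNReal.ofReal lam * (ENNReal.ofReal ((5 * K) ^ D) * μ (closedBall (z : X) (rad z)))
            = ENNReal.ofReal ((5 * K) ^ D / η * lam) *
                (ENNReal.ofReal η * μ (closedBall (z : X) (rad z))) := by
              rw [← mul_assoc, ← mul_assoc, ← ENNReal.ofReal_mul hlam.le,
                ← ENNReal.ofReal_mul (by positivity)]
              congr 2
              field_simp
          _ ≤ _ := by gcongr
    _ = ENNReal.ofReal ((5 * K) ^ D / η * lam) *
          ∑' z : u, μ (closedBall (z : X) (K * rad z) ∩ {y | β * lam < w y}) :=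
        ENNReal.tsum_mul_left
    _ ≤ _ := by
        gcongr
        have := hcount.to_subtype
        rw [← measure_iUnion (f := fun z : u => closedBall (z : X) (K * rad z) ∩
          {y | β * lam < w y})]
        · refine measure_mono (iUnion_subset fun z => inter_subset_inter_left _ ?_)
          intro y hy
          exact mem_thickening_iff.2
            ⟨z, (huG z.2).1, (mem_closedBall.1 hy).trans_lt (hKr z (huG z.2)).2⟩
        · intro a b hab
          exact (hdisj a.2 b.2 (fun h => hab (Subtype.ext h))).mono inter_subset_left
            inter_subset_left
        · exact fun z => measurableSet_closedBall.inter (measurableSet_lt measurable_const hw)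

end Metric

theorem lintegral_Ioc_rpow_sub_one {ε a : ℝ} (hε : 0 < ε) (ha : 0 < a) :
    ∫⁻ t in Ioc 0 a, ENNReal.ofReal (t ^ (ε - 1)) = ENNReal.ofReal (a ^ ε / ε) := by
  have hint : IntervalIntegrable (fun t : ℝ => t ^ (ε - 1)) volume 0 a :=
    intervalIntegral.intervalIntegrable_rpow' (by linarith)
  rw [← ofReal_integral_eq_lintegral_ofReal
    ((intervalIntegrable_iff_integrableOn_Ioc_of_le ha.le).1 hint)]
  · rw [← intervalIntegral.integral_of_le ha.le, integral_rpow (Or.inl (by linarith))]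
    simp [hε.ne']
  · filter_upwards [ae_restrict_mem measurableSet_Ioc] with t ht
    exact Real.rpow_nonneg ht.1.le _

section LayerCake

variable {X : Type*} [MeasurableSpace X] {μ : Measure X}

/-- The part of the truncated integral of `w ^ (1 + ε)` over the set `{w ≤ lam}`. -/
theorem lintegral_truncated_rpow_sublevel_le {w : X → ℝ} (hw : Measurable w) (hw0 : ∀ z, 0 ≤ w z)
    {E : Set X} (hE : MeasurableSet E) {k ε lam : ℝ} (hk : 0 < k) (hε : 0 < ε) (hlam : 0 < lam) :
    ∫⁻ y in E ∩ {y | w y ≤ lam}, ENNReal.ofReal (min (w y) k ^ ε) * ENNReal.ofReal (w y) ∂μ ≤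
      ENNReal.ofReal (lam ^ (1 + ε)) * μ E := by
  have hm : MeasurableSet (E ∩ {y | w y ≤ lam}) := hE.inter (measurableSet_le hw measurable_const)
  calc _ ≤ ∫⁻ y in E ∩ {y | w y ≤ lam}, ENNReal.ofReal (lam ^ (1 + ε)) ∂μ := by
        refine setLIntegral_mono' hm fun y hy => ?_
        have hy2 : w y ≤ lam := hy.2
        have h0 : 0 ≤ min (w y) k := le_min (hw0 y) hk.le
        rw [← ENNReal.ofReal_mul (Real.rpow_nonneg h0 _), add_comm 1 ε, Real.rpow_add hlam,
          Real.rpow_one]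
        refine ENNReal.ofReal_le_ofReal ?_
        gcongr
        · exact hw0 y
        · exact (min_le_left _ _).trans hy2
    _ = ENNReal.ofReal (lam ^ (1 + ε)) * μ (E ∩ {y | w y ≤ lam}) := by
        rw [lintegral_const, Measure.restrict_apply_univ]
    _ ≤ _ := by gcongr; exact inter_subset_left

/-- The part of the truncated integral of `w ^ (1 + ε)` over `{lam < w}`, estimated by means of a
level-set inequality for all levels `t ≥ lam`. -/
theorem lintegral_truncated_rpow_superlevel_le {w : X → ℝ} (hw : Measurable w)
    (hw0 : ∀ z, 0 ≤ w z) {E F : Set X}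
    {k ε lam C β : ℝ} (hk : 0 < k) (hε : 0 < ε) (hε1 : ε ≤ 1) (hlam : 0 < lam) (hC : 0 ≤ C)
    (hβ : 0 < β) (hβ1 : β ≤ 1)
    (hlev : ∀ t, lam ≤ t → ∫⁻ y in E ∩ {y | t < w y}, ENNReal.ofReal (w y) ∂μ ≤
      ENNReal.ofReal (C * t) * μ (F ∩ {y | β * t < w y})) :
    ∫⁻ y in E ∩ {y | lam < w y}, ENNReal.ofReal (min (w y) k ^ ε) * ENNReal.ofReal (w y) ∂μ ≤
      ENNReal.ofReal (C * lam ^ (1 + ε)) * μ F +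
        ENNReal.ofReal (C * ε / β ^ 2) *
          ∫⁻ y in F, ENNReal.ofReal (min (w y) k ^ ε) * ENNReal.ofReal (w y) ∂μ := by
  set f : X → ℝ≥0∞ := fun y => ENNReal.ofReal (w y) with hf_def
  have hf : Measurable f := hw.ennreal_ofReal
  set h : X → ℝ := fun y => min (w y) k with hh_def
  have hh : Measurable h := hw.min measurable_const
  have hh0 : ∀ y, 0 ≤ h y := fun y => le_min (hw0 y) hk.le
  have hhw : ∀ y, h y ≤ w y := fun y => min_le_left _ _
  set ν : Measure X := (μ.restrict (E ∩ {y | lam < w y})).withDensity f with hν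
  have hνle : ∀ t, 0 < t → ν {y | t < h y} ≤
      (if t ≤ lam then ENNReal.ofReal (C * lam) * μ F else 0) +
        ENNReal.ofReal (C * t) * μ.restrict F {y | t < h y / β} := by
    intro t ht
    have hset : MeasurableSet {y | t < h y} := measurableSet_lt measurable_const hh
    rw [hν, withDensity_apply _ hset, Measure.restrict_restrict hset]
    split_ifs with htl
    · refine le_add_right ?_
      calc _ ≤ ∫⁻ y in E ∩ {y | lam < w y}, f y ∂μ := lintegral_mono_set inter_subset_right
        _ ≤ ENNReal.ofReal (C * lam) * μ (F ∩ {y | β * lam < w y}) := hlev lam le_rfl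
        _ ≤ _ := by gcongr; exact inter_subset_left
    · push Not at htl
      rw [zero_add]
      by_cases htk : t < k
      · calc _ ≤ ∫⁻ y in E ∩ {y | t < w y}, f y ∂μ :=
              lintegral_mono_set fun y hy => ⟨hy.2.1, lt_of_lt_of_le hy.1 (hhw y)⟩
          _ ≤ ENNReal.ofReal (C * t) * μ (F ∩ {y | β * t < w y}) := hlev t htl.le
          _ ≤ _ := by
            rw [Measure.restrict_apply (measurableSet_lt measurable_const (hh.div_const β))]
            refine mul_le_mul' le_rfl (measure_mono fun y hy => ⟨?_, hy.1⟩)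
            have hy2 : β * t < w y := hy.2
            change t < h y / β
            rw [lt_div_iff₀ hβ, mul_comm]
            exact lt_min hy2 (by nlinarith)
      · have : {y | t < h y} = ∅ := by
          ext y
          simp only [mem_ofPred_eq, mem_empty_iff_false, iff_false, not_lt]
          exact (min_le_right _ _).trans (not_lt.1 htk)
        rw [this]
        simp
  have hνint : ∫⁻ y in E ∩ {y | lam < w y}, ENNReal.ofReal (h y ^ ε) * f y ∂μ =
      ∫⁻ y, ENNReal.ofReal (h y ^ ε) ∂ν := by
    rw [hν, lintegral_withDensity_eq_lintegral_mul _ hf (hh.pow_const ε).ennreal_ofReal]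
    simp only [Pi.mul_apply, mul_comm]
  have hFint : ∫⁻ t in Ioi (0 : ℝ), μ.restrict F {y | t < h y / β} * ENNReal.ofReal (t ^ ε) ≤
      ENNReal.ofReal (1 / β ^ 2) * ∫⁻ y in F, ENNReal.ofReal (h y ^ ε) * f y ∂μ := by
    have h1 := lintegral_rpow_eq_lintegral_meas_lt_mul (μ.restrict F) (f := fun y => h y / β)
      (Eventually.of_forall fun y => div_nonneg (hh0 y) hβ.le) (hh.div_const β).aemeasurable
      (p := 1 + ε) (by linarith)
    simp only [add_sub_cancel_left] at h1
    calc _ ≤ ENNReal.ofReal (1 + ε) *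
          ∫⁻ t in Ioi (0 : ℝ), μ.restrict F {y | t < h y / β} * ENNReal.ofReal (t ^ ε) := by
          refine le_mul_of_one_le_left' ?_
          rw [ENNReal.one_le_ofReal]; linarith
      _ = ∫⁻ y in F, ENNReal.ofReal ((h y / β) ^ (1 + ε)) ∂μ := h1.symm
      _ ≤ ∫⁻ y in F, ENNReal.ofReal (1 / β ^ 2) * (ENNReal.ofReal (h y ^ ε) * f y) ∂μ := by
          refine lintegral_mono fun y => ?_
          change _ ≤ ENNReal.ofReal (1 / β ^ 2) * (ENNReal.ofReal (h y ^ ε) * ENNReal.ofReal (w y))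
          rw [← ENNReal.ofReal_mul (Real.rpow_nonneg (hh0 y) _),
            ← ENNReal.ofReal_mul (by positivity)]
          refine ENNReal.ofReal_le_ofReal ?_
          rw [Real.div_rpow (hh0 y) hβ.le, div_eq_mul_one_div, mul_comm]
          have hβε : 1 / β ^ (1 + ε) ≤ 1 / β ^ 2 := by
            refine one_div_le_one_div_of_le (by positivity) ?_
            rw [← Real.rpow_natCast]
            exact Real.rpow_le_rpow_of_exponent_ge hβ hβ1 (by push_cast; linarith)
          have hhε : h y ^ (1 + ε) ≤ h y ^ ε * w y := by
            rw [add_comm, Real.rpow_add_of_nonneg (hh0 y) hε.le zero_le_one, Real.rpow_one]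
            exact mul_le_mul_of_nonneg_left (hhw y) (Real.rpow_nonneg (hh0 y) _)
          exact mul_le_mul hβε hhε (Real.rpow_nonneg (hh0 y) _) (by positivity)
      _ = _ := lintegral_const_mul _ ((hh.pow_const ε).ennreal_ofReal.mul hf)
  have hmeas : Measurable fun t : ℝ =>
      (if t ≤ lam then ENNReal.ofReal (C * lam) * μ F else 0) * ENNReal.ofReal (t ^ (ε - 1)) :=
    (Measurable.ite measurableSet_Iic measurable_const measurable_const).mul
      (measurable_id.pow_const _).ennreal_ofReal
  rw [hνint, lintegral_rpow_eq_lintegral_meas_lt_mul ν (Eventually.of_forall hh0)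
    hh.aemeasurable hε]
  calc ENNReal.ofReal ε * ∫⁻ t in Ioi (0 : ℝ), ν {y | t < h y} * ENNReal.ofReal (t ^ (ε - 1))
      ≤ ENNReal.ofReal ε * ∫⁻ t in Ioi (0 : ℝ),
          ((if t ≤ lam then ENNReal.ofReal (C * lam) * μ F else 0) *
            ENNReal.ofReal (t ^ (ε - 1)) +
          ENNReal.ofReal C * (μ.restrict F {y | t < h y / β} * ENNReal.ofReal (t ^ ε))) := by
        refine mul_le_mul' le_rfl ?_
        refine setLIntegral_mono' measurableSet_Ioi fun t ht => ?_
        have ht : 0 < t := ht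
        refine (mul_le_mul_left (hνle t ht) _).trans ?_
        rw [add_mul]
        refine add_le_add le_rfl (le_of_eq ?_)
        rw [mul_right_comm, ← ENNReal.ofReal_mul (by positivity), mul_assoc C, mul_comm t,
          ← Real.rpow_add_one ht.ne', sub_add_cancel, ENNReal.ofReal_mul hC]
        ring
    _ = ENNReal.ofReal ε * ((∫⁻ t in Ioi (0 : ℝ),
          (if t ≤ lam then ENNReal.ofReal (C * lam) * μ F else 0) *
            ENNReal.ofReal (t ^ (ε - 1))) +
          ENNReal.ofReal C * ∫⁻ t in Ioi (0 : ℝ),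
            μ.restrict F {y | t < h y / β} * ENNReal.ofReal (t ^ ε)) := by
        rw [lintegral_add_left hmeas, lintegral_const_mul' _ _ ENNReal.ofReal_ne_top]
    _ ≤ ENNReal.ofReal ε * (ENNReal.ofReal (C * lam) * μ F * ENNReal.ofReal (lam ^ ε / ε) +
          ENNReal.ofReal C * (ENNReal.ofReal (1 / β ^ 2) *
            ∫⁻ y in F, ENNReal.ofReal (h y ^ ε) * f y ∂μ)) := by
        gcongr
        rw [← lintegral_Ioc_rpow_sub_one hε hlam, ← lintegral_const_mul _
          (f := fun t : ℝ => ENNReal.ofReal (t ^ (ε - 1)))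
          (measurable_id.pow_const _).ennreal_ofReal, ← lintegral_indicator measurableSet_Ioi,
          ← lintegral_indicator measurableSet_Ioc]
        refine lintegral_mono fun t => ?_
        by_cases h0 : 0 < t <;> by_cases h1 : t ≤ lam <;> simp [indicator, h0, h1]
    _ = _ := by
        rw [mul_add]
        congr 1
        · rw [mul_right_comm (ENNReal.ofReal (C * lam)), ← mul_assoc,
            ← ENNReal.ofReal_mul (by positivity), ← ENNReal.ofReal_mul (by positivity)]
          congr 2
          rw [Real.rpow_add hlam, Real.rpow_one]
          field_simp
        · rw [← mul_assoc, ← mul_assoc, ← ENNReal.ofReal_mul hε.le,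
            ← ENNReal.ofReal_mul (by positivity)]
          congr 2
          field_simp

end LayerCake

/-- Absorption along a sequence: a bounded solution of `Φ i ≤ H * b ^ i + θ * Φ (i + 1)` with
`θ * b ≤ 1 / 2` and `θ ≤ 1 / 2` satisfies `Φ 0 ≤ 2 * H`. -/
theorem le_two_mul_of_le_add_mul_succ {Φ : ℕ → ℝ≥0∞} {H b θ T : ℝ≥0∞} (hT : T ≠ ∞)
    (hΦT : ∀ i, Φ i ≤ T) (hθ : θ ≤ 1 / 2) (hθb : θ * b ≤ 1 / 2)
    (hΦ : ∀ i, Φ i ≤ H * b ^ i + θ * Φ (i + 1)) : Φ 0 ≤ 2 * H := by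
  have key : ∀ N, Φ 0 ≤ (∑ i ∈ Finset.range N, (1 / 2) ^ i * H) + (1 / 2) ^ N * T := by
    have h1 : ∀ N, Φ 0 ≤ (∑ i ∈ Finset.range N, (1 / 2) ^ i * H) + θ ^ N * Φ N := by
      intro N
      induction N with
      | zero => simp
      | succ N ih =>
        refine ih.trans ?_
        rw [Finset.sum_range_succ, add_assoc]
        gcongr
        calc θ ^ N * Φ N ≤ θ ^ N * (H * b ^ N + θ * Φ (N + 1)) := by gcongr; exact hΦ N
          _ = (θ * b) ^ N * H + θ ^ (N + 1) * Φ (N + 1) := by ring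
          _ ≤ _ := by gcongr
    intro N
    refine (h1 N).trans ?_
    gcongr
    exact hΦT N
  have hsum : ∀ N, (∑ i ∈ Finset.range N, ((1 : ℝ≥0∞) / 2) ^ i * H) ≤ 2 * H := by
    intro N
    rw [← Finset.sum_mul]
    gcongr
    refine (ENNReal.sum_le_tsum _).trans (le_of_eq ?_)
    rw [ENNReal.tsum_geometric, one_div, ENNReal.one_sub_inv_two, inv_inv]
  have hlim : Tendsto (fun N : ℕ => 2 * H + ((1 : ℝ≥0∞) / 2) ^ N * T) atTop
      (𝓝 (2 * H + 0 * T)) := by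
    refine tendsto_const_nhds.add (ENNReal.Tendsto.mul_const ?_ (Or.inr hT))
    exact ENNReal.tendsto_pow_atTop_nhds_zero_of_lt_one (by
      rw [one_div]; exact ENNReal.inv_lt_one.2 (by norm_num))
  rw [zero_mul, add_zero] at hlim
  exact ge_of_tendsto' hlim fun N => (key N).trans (by gcongr; exact hsum N)

section Gehring

variable {X : Type*} [MetricSpace X] [MeasurableSpace X] {μ : Measure X} {c D : ℝ}
  [BorelSpace X] [SecondCountableTopology X]

/-- One absorption step for the truncated integral of `w ^ (1 + ε)` on a set `U`. -/
theorem HasBallMeasure.lintegral_truncated_rpow_le (hμ : HasBallMeasure μ c D) (hc : 0 < c)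
    (hD : 0 < D) {w : X → ℝ} (hw : Measurable w) (hw0 : ∀ z, 0 ≤ w z) {K η β : ℝ} (hK : 1 ≤ K)
    (hη : 0 < η) (hβ : 0 < β) (hβ1 : β ≤ 1) (hd : HasDenseSuperlevels μ w K η β) {U : Set X}
    (hU : MeasurableSet U) {s r₀ lam₀ k ε : ℝ} (hs : 0 < s) (hsr : s ≤ r₀) (hlam : 0 < lam₀)
    (hk : 0 < k) (hε : 0 < ε) (hε1 : ε ≤ 1)
    (hfin : ∫⁻ y in thickening s U, ENNReal.ofReal (w y) ∂μ ≠ ∞)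
    (havg : ∀ z ∈ U, ∫⁻ y in closedBall z r₀, ENNReal.ofReal (w y) ∂μ ≤
      ENNReal.ofReal lam₀ * μ (closedBall z r₀)) :
    ∫⁻ y in U, ENNReal.ofReal (min (w y) k ^ ε) * ENNReal.ofReal (w y) ∂μ ≤
      ENNReal.ofReal ((1 + (5 * K) ^ D / η) * (lam₀ * (5 * K * r₀ / s) ^ D) ^ (1 + ε)) *
          μ (thickening s U) +
        ENNReal.ofReal ((5 * K) ^ D / η * ε / β ^ 2) * ∫⁻ y in thickening s U,
          ENNReal.ofReal (min (w y) k ^ ε) * ENNReal.ofReal (w y) ∂μ := by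
  have hKpos : 0 < K := by linarith
  have hr₀ : 0 < r₀ := by linarith
  set lam := lam₀ * (5 * K * r₀ / s) ^ D with hlam_def
  have hlampos : 0 < lam := by positivity
  have hlev : ∀ t, lam ≤ t → ∫⁻ y in U ∩ {y | t < w y}, ENNReal.ofReal (w y) ∂μ ≤
      ENNReal.ofReal ((5 * K) ^ D / η * t) * μ (thickening s U ∩ {y | β * t < w y}) := by
    intro t ht
    refine hμ.lintegral_superlevel_le hc hw hK hη hd hs hfin (hlampos.trans_le ht) ?_
    intro z hz r hr hrs
    have hr0 : 0 < r := lt_of_lt_of_le (by positivity) hr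
    calc ∫⁻ y in closedBall z r, ENNReal.ofReal (w y) ∂μ
        ≤ ∫⁻ y in closedBall z r₀, ENNReal.ofReal (w y) ∂μ :=
          lintegral_mono_set (closedBall_subset_closedBall (hrs.trans hsr))
      _ ≤ ENNReal.ofReal lam₀ * μ (closedBall z (r₀ / r * r)) := by
          rw [div_mul_cancel₀ _ hr0.ne']; exact havg z hz
      _ = ENNReal.ofReal (lam₀ * (r₀ / r) ^ D) * μ (closedBall z r) := by
          rw [hμ.measure_mul z (by positivity) hr0, ← mul_assoc, ← ENNReal.ofReal_mul hlam.le]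
      _ ≤ _ := by
          gcongr
          refine le_trans ?_ ht
          rw [hlam_def]
          gcongr lam₀ * ?_ ^ D
          rw [div_le_iff₀ (by positivity)] at hr
          rw [div_le_div_iff₀ hr0 hs]
          nlinarith
  have hsplit : U ⊆ (U ∩ {y | w y ≤ lam}) ∪ (U ∩ {y | lam < w y}) := by
    intro y hy
    rcases le_or_gt (w y) lam with h | h
    · exact Or.inl ⟨hy, h⟩
    · exact Or.inr ⟨hy, h⟩
  have hUT : U ⊆ thickening s U := self_subset_thickening hs U
  refine (lintegral_mono_set hsplit).trans ((lintegral_union_le _ _ _).trans ?_)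
  refine (add_le_add (lintegral_truncated_rpow_sublevel_le hw hw0 hU hk hε hlampos)
    (lintegral_truncated_rpow_superlevel_le hw hw0 hk hε hε1 hlampos (by positivity) hβ hβ1
      hlev)).trans ?_
  rw [← add_assoc, one_add_mul, ENNReal.ofReal_add (by positivity) (by positivity), add_mul]
  gcongr

/-- A reverse Hölder estimate: if `w` has dense superlevel sets, then averages of
`w ^ (1 + ε)` are controlled by averages of `w` over slightly larger sets. -/
theorem HasBallMeasure.exists_lintegral_rpow_le (hμ : HasBallMeasure μ c D) (hc : 0 < c)
    (hD : 0 < D) {w : X → ℝ} (hw : Measurable w) (hw0 : ∀ z, 0 ≤ w z) {K η β : ℝ} (hK : 1 ≤ K)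
    (hη : 0 < η) (hβ : 0 < β) (hβ1 : β ≤ 1) (hd : HasDenseSuperlevels μ w K η β) :
    ∃ ε C : ℝ, 0 < ε ∧ 0 < C ∧ ∀ (A : Set X) (r₀ lam₀ : ℝ), 0 < r₀ → 0 < lam₀ →
      ∫⁻ y in thickening r₀ A, ENNReal.ofReal (w y) ∂μ ≠ ∞ →
      (∀ z ∈ thickening r₀ A, ∫⁻ y in closedBall z r₀, ENNReal.ofReal (w y) ∂μ ≤
        ENNReal.ofReal lam₀ * μ (closedBall z r₀)) →
      ∫⁻ y in A, ENNReal.ofReal (w y) ^ (1 + ε) ∂μ ≤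
        ENNReal.ofReal (C * lam₀ ^ (1 + ε)) * μ (thickening r₀ A) := by
  have hKpos : 0 < K := by linarith
  set C₀ := (5 * K) ^ D / η with hC₀
  have hC₀pos : 0 < C₀ := by positivity
  set b : ℝ := (2 : ℝ) ^ D with hb
  have hb1 : 1 ≤ b := Real.one_le_rpow one_le_two hD.le
  set q : ℝ := C₀ / β ^ 2 * b ^ 2 with hq
  have hqpos : 0 < q := by positivity
  set ε : ℝ := min 1 (1 / (2 * q)) with hε_def
  have hε : 0 < ε := lt_min one_pos (by positivity)
  have hε1 : ε ≤ 1 := min_le_left _ _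
  have hεq : ε * q ≤ 1 / 2 := by
    have : ε ≤ 1 / (2 * q) := min_le_right _ _
    rw [le_div_iff₀ (by positivity)] at this
    linarith
  refine ⟨ε, 2 * ((1 + C₀) * ((20 * K) ^ D) ^ (1 + ε)), hε, by positivity, ?_⟩
  intro A r₀ lam₀ hr₀ hlam hfin havg
  set T := thickening r₀ A with hT
  set f : X → ℝ≥0∞ := fun y => ENNReal.ofReal (w y) with hf_def
  have hf : Measurable f := hw.ennreal_ofReal
  set H : ℝ≥0∞ := ENNReal.ofReal ((1 + C₀) * (lam₀ * (20 * K) ^ D) ^ (1 + ε)) * μ T with hH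
  let U : ℕ → Set X := fun i => thickening (r₀ * (1 - (1 / 2) ^ (i + 1))) A
  have hUT : ∀ i, U i ⊆ T := fun i => thickening_mono (by
    have : (0 : ℝ) < (1 / 2) ^ (i + 1) := by positivity
    nlinarith) A
  have hUs : ∀ i, thickening (r₀ * (1 / 2) ^ (i + 2)) (U i) ⊆ U (i + 1) := fun i => by
    refine (thickening_thickening_subset _ _ _).trans (thickening_mono (le_of_eq ?_) _)
    ring
  have hAU : A ⊆ U 0 := self_subset_thickening (by norm_num; exact hr₀) A
  have htrunc : ∀ k : ℝ, 0 < k →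
      ∫⁻ y in A, ENNReal.ofReal (min (w y) k ^ ε) * f y ∂μ ≤ 2 * H := by
    intro k hk
    refine (lintegral_mono_set hAU).trans ?_
    refine le_two_mul_of_le_add_mul_succ
      (Φ := fun i => ∫⁻ y in U i, ENNReal.ofReal (min (w y) k ^ ε) * f y ∂μ)
      (b := ENNReal.ofReal (b ^ 2)) (θ := ENNReal.ofReal (C₀ * ε / β ^ 2))
      (T := ENNReal.ofReal (k ^ ε) * ∫⁻ y in T, f y ∂μ)
      (ENNReal.mul_ne_top ENNReal.ofReal_ne_top hfin) ?_ ?_ ?_ ?_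
    · intro i
      refine (lintegral_mono_set (hUT i)).trans ?_
      rw [← lintegral_const_mul _ hf]
      refine lintegral_mono fun y => mul_le_mul' (ENNReal.ofReal_le_ofReal ?_) le_rfl
      exact Real.rpow_le_rpow (le_min (hw0 y) hk.le) (min_le_right _ _) hε.le
    · rw [← ENNReal.ofReal_one, ← ENNReal.ofReal_ofNat 2, ← ENNReal.ofReal_div_of_pos two_pos]
      refine ENNReal.ofReal_le_ofReal (le_trans ?_ hεq)
      have hb2 : 1 ≤ b ^ 2 := one_le_pow₀ hb1
      calc C₀ * ε / β ^ 2 = ε * (C₀ / β ^ 2) * 1 := by ring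
        _ ≤ ε * (C₀ / β ^ 2) * b ^ 2 := by gcongr
        _ = ε * q := by rw [hq]; ring
    · rw [← ENNReal.ofReal_one, ← ENNReal.ofReal_ofNat 2, ← ENNReal.ofReal_div_of_pos two_pos,
        ← ENNReal.ofReal_mul (by positivity)]
      refine ENNReal.ofReal_le_ofReal (le_trans (le_of_eq ?_) hεq)
      rw [hq]; ring
    · intro i
      have hhalf : (0 : ℝ) < (1 / 2) ^ (i + 2) := by positivity
      have hhalf1 : ((1 : ℝ) / 2) ^ (i + 2) ≤ 1 := pow_le_one₀ (by norm_num) (by norm_num)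
      have hsT : thickening (r₀ * (1 / 2) ^ (i + 2)) (U i) ⊆ T := (hUs i).trans (hUT _)
      have h1 := hμ.lintegral_truncated_rpow_le hc hD hw hw0 hK hη hβ hβ1 hd (U := U i)
        isOpen_thickening.measurableSet (s := r₀ * (1 / 2) ^ (i + 2)) (r₀ := r₀) (lam₀ := lam₀)
        (k := k) (ε := ε) (by positivity) (by nlinarith) hlam hk hε hε1
        (ne_top_of_le_ne_top hfin (lintegral_mono_set hsT)) fun z hz => havg z (hUT i hz)
      refine h1.trans ?_
      have hscale : 5 * K * r₀ / (r₀ * (1 / 2) ^ (i + 2)) = 20 * K * 2 ^ i := by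
        have h2 : ((1 : ℝ) / 2) ^ (i + 2) * (4 * 2 ^ i) = 1 := by
          rw [one_div, inv_pow, pow_add]
          field_simp
          norm_num
        rw [div_eq_iff (by positivity)]
        calc 5 * K * r₀ = 5 * K * r₀ * ((1 / 2) ^ (i + 2) * (4 * 2 ^ i)) := by rw [h2, mul_one]
          _ = _ := by ring
      have hpow : ((lam₀ * (20 * K * 2 ^ i) ^ D) ^ (1 + ε)) ≤
          (lam₀ * (20 * K) ^ D) ^ (1 + ε) * (b ^ 2) ^ i := by
        have hbi : ((2 : ℝ) ^ i) ^ D = b ^ i := by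
          rw [hb, ← Real.rpow_natCast, ← Real.rpow_natCast, ← Real.rpow_mul (by norm_num),
            ← Real.rpow_mul (by norm_num), mul_comm]
        rw [Real.mul_rpow (x := 20 * K) (by positivity) (by positivity), hbi, ← mul_assoc,
          Real.mul_rpow (by positivity) (by positivity)]
        gcongr
        rw [← pow_mul, mul_comm 2 i, pow_mul, ← Real.rpow_natCast (b ^ i) 2]
        exact Real.rpow_le_rpow_of_exponent_le (one_le_pow₀ hb1) (by push_cast; linarith)
      refine add_le_add ?_ (mul_le_mul' le_rfl (lintegral_mono_set (hUs i)))
      rw [hscale, hH, mul_right_comm _ (μ T), ← ENNReal.ofReal_pow (by positivity),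
        ← ENNReal.ofReal_mul (by positivity)]
      refine mul_le_mul' (ENNReal.ofReal_le_ofReal ?_) (measure_mono hsT)
      rw [mul_assoc (1 + C₀)]
      exact mul_le_mul_of_nonneg_left hpow (by positivity)
  have hlim : ∫⁻ y in A, f y ^ (1 + ε) ∂μ ≤ 2 * H := by
    have hsup : ∀ y, f y ^ (1 + ε) =
        ⨆ n : ℕ, ENNReal.ofReal (min (w y) (n + 1) ^ ε) * f y := by
      intro y
      refine le_antisymm ?_ (iSup_le fun n => ?_)
      · obtain ⟨n, hn⟩ := exists_nat_ge (w y)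
        refine le_iSup_of_le n (le_of_eq ?_)
        rw [min_eq_left (by linarith), add_comm 1 ε, ENNReal.rpow_add_of_nonneg _ _ hε.le zero_le_one,
          ENNReal.rpow_one, hf_def, ENNReal.ofReal_rpow_of_nonneg (hw0 y) hε.le]
      · rw [add_comm 1 ε, ENNReal.rpow_add_of_nonneg _ _ hε.le zero_le_one,
          ENNReal.rpow_one, hf_def, ENNReal.ofReal_rpow_of_nonneg (hw0 y) hε.le]
        gcongr
        · exact le_min (hw0 y) (by positivity)
        · exact min_le_left _ _
    simp_rw [hsup]
    rw [lintegral_iSup]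
    · exact iSup_le fun n => htrunc _ (by positivity)
    · exact fun n => ((hw.min measurable_const).pow_const ε).ennreal_ofReal.mul hf
    · intro m n hmn y
      have hmn' : (m : ℝ) ≤ n := by exact_mod_cast hmn
      refine mul_le_mul' (ENNReal.ofReal_le_ofReal ?_) le_rfl
      exact Real.rpow_le_rpow (le_min (hw0 y) (by positivity))
        (min_le_min le_rfl (by linarith)) hε.le
  refine hlim.trans (le_of_eq ?_)
  rw [hH, ← mul_assoc, ← ENNReal.ofReal_ofNat 2, ← ENNReal.ofReal_mul (by norm_num),
    Real.mul_rpow hlam.le (by positivity)]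
  congr 2
  ring

end Gehring

theorem ennreal_rpow_le_rpow_of_nonpos {x y : ℝ≥0∞} {e : ℝ} (h : x ≤ y) (he : e ≤ 0) :
    y ^ e ≤ x ^ e := by
  obtain ⟨e, rfl⟩ : ∃ e', e = -e' := ⟨-e, (neg_neg e).symm⟩
  rw [ENNReal.rpow_neg, ENNReal.rpow_neg, ENNReal.inv_le_inv]
  exact ENNReal.rpow_le_rpow h (by linarith)

theorem spaceCube_eq_closedBall {n : ℕ} (x : Fin n → ℝ) {r : ℝ} (hr : 0 ≤ r) :
    spaceCube x r = closedBall x r := by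
  ext y
  simp [spaceCube, dist_pi_le_iff hr, Real.dist_eq]

theorem measurableSet_spaceCube {n : ℕ} (x : Fin n → ℝ) {r : ℝ} (hr : 0 ≤ r) :
    MeasurableSet (spaceCube x r) := by
  rw [spaceCube_eq_closedBall x hr]; exact measurableSet_closedBall

theorem spaceCube_subset_spaceCube {n : ℕ} {x y : Fin n → ℝ} {r s : ℝ}
    (h : ∀ i, |x i - y i| + r ≤ s) : spaceCube x r ⊆ spaceCube y s := by
  intro z hz i
  have h1 := abs_add_le (z i - x i) (x i - y i)
  rw [sub_add_sub_cancel] at h1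
  linarith [h i, hz i]

theorem volume_spaceCube {n : ℕ} (x : Fin n → ℝ) {r : ℝ} (hr : 0 ≤ r) :
    volume (spaceCube x r) = ENNReal.ofReal ((2 * r) ^ n) := by
  rw [spaceCube_eq_closedBall x hr, Real.volume_pi_closedBall x hr, Fintype.card_fin]

theorem volume_spaceCube_prod_Ioo {n : ℕ} (x : Fin n → ℝ) {r : ℝ} (hr : 0 ≤ r) (a b : ℝ) :
    volume (spaceCube x r ×ˢ Ioo a b : Set (SpaceTime n)) =
      ENNReal.ofReal ((2 * r) ^ n * (b - a)) := by
  rw [Measure.volume_eq_prod, Measure.prod_prod, volume_spaceCube x hr, Real.volume_Ioo,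
    ← ENNReal.ofReal_mul (by positivity)]

theorem volume_rectUpper {n : ℕ} (p γ : ℝ) (x : Fin n → ℝ) (t : ℝ) {L : ℝ} (hL : 0 ≤ L) :
    volume (rectUpper p γ x t L) = ENNReal.ofReal ((2 * L) ^ n * ((1 - γ) * L ^ p)) := by
  rw [rectUpper, volume_spaceCube_prod_Ioo x hL]
  congr 2; ring

theorem volume_rectLower {n : ℕ} (p γ : ℝ) (x : Fin n → ℝ) (t : ℝ) {L : ℝ} (hL : 0 ≤ L) :
    volume (rectLower p γ x t L) = ENNReal.ofReal ((2 * L) ^ n * ((1 - γ) * L ^ p)) := by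
  rw [rectLower, volume_spaceCube_prod_Ioo x hL]
  congr 2; ring

theorem measurableSet_rectUpper {n : ℕ} (p γ : ℝ) (x : Fin n → ℝ) (t : ℝ) {L : ℝ} (hL : 0 ≤ L) :
    MeasurableSet (rectUpper p γ x t L) :=
  (measurableSet_spaceCube x hL).prod measurableSet_Ioo

/-- Space-time with the parabolic metric `max (‖x - y‖_∞, |t - s| ^ (1 / p))`. -/
def ParabolicSpace (n : ℕ) (p : ℝ) (_ : 1 < p) : Type := SpaceTime n

namespace ParabolicSpace

variable {n : ℕ} {p : ℝ} {hp : 1 < p}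

noncomputable instance : MeasureSpace (ParabolicSpace n p hp) :=
  inferInstanceAs (MeasureSpace (SpaceTime n))

instance : TopologicalSpace (ParabolicSpace n p hp) :=
  inferInstanceAs (TopologicalSpace (SpaceTime n))

instance : BorelSpace (ParabolicSpace n p hp) := inferInstanceAs (BorelSpace (SpaceTime n))

instance : SecondCountableTopology (ParabolicSpace n p hp) :=
  inferInstanceAs (SecondCountableTopology (SpaceTime n))

theorem one_div_pos_of (hp : 1 < p) : 0 < 1 / p := by positivity

theorem one_div_le_one_of (hp : 1 < p) : 1 / p ≤ 1 := by
  rw [div_le_one (by linarith)]; exact hp.le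

/-- The identification of `ParabolicSpace` with a product whose second factor is a snowflake. -/
noncomputable def toProd (z : ParabolicSpace n p hp) :
    (Fin n → ℝ) × Snowflaking ℝ (1 / p) (one_div_pos_of hp) (one_div_le_one_of hp) :=
  Prod.map id Snowflaking.toSnowflaking z

theorem isEmbedding_toProd : IsEmbedding (toProd (n := n) (hp := hp)) :=
  IsEmbedding.id.prodMap Snowflaking.homeomorph.symm.isEmbedding

noncomputable instance : MetricSpace (ParabolicSpace n p hp) := isEmbedding_toProd.comapMetricSpace toProd

theorem closedBall_eq (z : ParabolicSpace n p hp) {r : ℝ} (hr : 0 ≤ r) :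
    closedBall z r = (spaceCube z.1 r ×ˢ Icc (z.2 - r ^ p) (z.2 + r ^ p) : Set (SpaceTime n)) := by
  have hp0 : 0 < p := by linarith
  ext y
  change max (dist y.1 z.1) (|y.2 - z.2| ^ (1 / p)) ≤ r ↔ y.1 ∈ spaceCube z.1 r ∧ _
  rw [max_le_iff, spaceCube_eq_closedBall z.1 hr, mem_closedBall, one_div,
    Real.rpow_inv_le_iff_of_pos (abs_nonneg _) hr hp0, mem_Icc, abs_le]
  constructor <;> rintro ⟨h1, h2, h3⟩ <;> refine ⟨h1, ?_, ?_⟩ <;> linarith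

theorem hasBallMeasure : HasBallMeasure
    (volume : Measure (ParabolicSpace n p hp)) (2 ^ (n + 1)) (n + p) := by
  intro z r hr
  rw [closedBall_eq z hr.le]
  change volume (spaceCube z.1 r ×ˢ Icc (z.2 - r ^ p) (z.2 + r ^ p) : Set (SpaceTime n)) = _
  rw [Measure.volume_eq_prod, Measure.prod_prod, volume_spaceCube z.1 hr.le, Real.volume_Icc,
    ← ENNReal.ofReal_mul (by positivity), Real.rpow_add hr, Real.rpow_natCast]
  congr 1; ring

theorem lintegral_closedBall_ne_top {w : SpaceTime n → ℝ} (hw : LocallyIntegrable w volume)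
    (z : ParabolicSpace n p hp) {r : ℝ} (hr : 0 ≤ r) :
    ∫⁻ y in (closedBall z r : Set (ParabolicSpace n p hp)), ENNReal.ofReal (w y)
      ∂(volume : Measure (SpaceTime n)) ≠ ∞ := by
  have hK : IsCompact (spaceCube z.1 r ×ˢ Icc (z.2 - r ^ p) (z.2 + r ^ p) :
      Set (SpaceTime n)) := by
    rw [spaceCube_eq_closedBall z.1 hr]
    exact (isCompact_closedBall _ _).prod isCompact_Icc
  rw [closedBall_eq z hr]
  exact ((lintegral_ofReal_le_lintegral_enorm w).trans_lt
    (hw.integrableOn_isCompact hK).hasFiniteIntegral).ne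

end ParabolicSpace

/-- Averages over the lower part of a parabolic rectangle control `w` from below on a large
part of the upper part. -/
def HasLowerBound {n : ℕ} (p γ : ℝ) (w : SpaceTime n → ℝ) (α β : ℝ) : Prop :=
  ∀ (x : Fin n → ℝ) (t L lam : ℝ), 0 < L → 0 < lam →
    ENNReal.ofReal lam * volume (rectLower p γ x t L) ≤
      ∫⁻ z in rectLower p γ x t L, ENNReal.ofReal (w z) →
    volume (rectUpper p γ x t L ∩ {z | w z ≤ β * lam}) ≤
      ENNReal.ofReal α * volume (rectUpper p γ x t L)

theorem hasLowerBound_of_aqConst {n : ℕ} {p q γ : ℝ} (hq : 1 < q) (hγ₁ : γ < 1)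
    {w : SpaceTime n → ℝ} (hw : Measurable w) (hA : aqConst p q γ w < ∞) {α : ℝ}
    (hα : 0 < α) : ∃ β, 0 < β ∧ β ≤ 1 ∧ HasLowerBound p γ w α β := by
  set M : ℝ := (aqConst p q γ w).toReal with hM
  have hM0 : 0 ≤ M := ENNReal.toReal_nonneg
  have hMA : aqConst p q γ w = ENNReal.ofReal M := (ENNReal.ofReal_toReal hA.ne).symm
  have hq1 : 0 < q - 1 := by linarith
  set β : ℝ := min 1 (α ^ (q - 1) / (M + 1)) with hβ_def
  have hβ : 0 < β := lt_min one_pos (by positivity)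
  refine ⟨β, hβ, min_le_left _ _, ?_⟩
  intro x t L lam hL hlam havg
  set Rm := rectLower p γ x t L with hRm
  set Rp := rectUpper p γ x t L with hRp
  have hvol : 0 < (2 * L) ^ n * ((1 - γ) * L ^ p) := by
    have : 0 < 1 - γ := by linarith
    positivity
  have hRm0 : volume Rm ≠ 0 := by
    rw [hRm, volume_rectLower p γ x t hL.le]; exact (ENNReal.ofReal_pos.2 hvol).ne'
  have hRm1 : volume Rm ≠ ∞ := by
    rw [hRm, volume_rectLower p γ x t hL.le]; exact ENNReal.ofReal_ne_top
  have hRp0 : volume Rp ≠ 0 := by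
    rw [hRp, volume_rectUpper p γ x t hL.le]; exact (ENNReal.ofReal_pos.2 hvol).ne'
  have hRp1 : volume Rp ≠ ∞ := by
    rw [hRp, volume_rectUpper p γ x t hL.le]; exact ENNReal.ofReal_ne_top
  set ρ : ℝ≥0∞ := volume (Rp ∩ {z | w z ≤ β * lam}) / volume Rp with hρ
  have hsup : (⨍⁻ z in Rm, ENNReal.ofReal (w z) ∂volume) *
      (⨍⁻ z in Rp, ENNReal.ofReal (w z) ^ (1 / (1 - q)) ∂volume) ^ (q - 1) ≤
        ENNReal.ofReal M := by
    rw [← hMA]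
    exact le_iSup_of_le x (le_iSup_of_le t (le_iSup_of_le L (le_iSup_of_le hL le_rfl)))
  have h1 : ENNReal.ofReal lam ≤ ⨍⁻ z in Rm, ENNReal.ofReal (w z) ∂volume := by
    rw [setLAverage_eq, ENNReal.le_div_iff_mul_le (Or.inl hRm0) (Or.inl hRm1)]
    exact havg
  have hneg : 1 / (1 - q) ≤ 0 := by
    apply div_nonpos_of_nonneg_of_nonpos <;> linarith
  have h2 : ENNReal.ofReal (β * lam) ^ (1 / (1 - q)) * ρ ≤
      ⨍⁻ z in Rp, ENNReal.ofReal (w z) ^ (1 / (1 - q)) ∂volume := by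
    rw [setLAverage_eq, hρ, ← mul_div_assoc]
    refine ENNReal.div_le_div_right ?_ _
    have hms : MeasurableSet (Rp ∩ {z | w z ≤ β * lam}) :=
      (measurableSet_rectUpper p γ x t hL.le).inter (measurableSet_le hw measurable_const)
    calc _ = ∫⁻ z in Rp ∩ {z | w z ≤ β * lam}, ENNReal.ofReal (β * lam) ^ (1 / (1 - q)) := by
          rw [lintegral_const, Measure.restrict_apply_univ]
      _ ≤ ∫⁻ z in Rp ∩ {z | w z ≤ β * lam}, ENNReal.ofReal (w z) ^ (1 / (1 - q)) := by
          refine setLIntegral_mono' hms fun z hz => ?_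
          exact ennreal_rpow_le_rpow_of_nonpos (ENNReal.ofReal_le_ofReal hz.2) hneg
      _ ≤ _ := lintegral_mono_set inter_subset_left
  have h3 : ENNReal.ofReal (1 / β) * ρ ^ (q - 1) ≤ ENNReal.ofReal M := by
    refine le_trans (le_of_eq ?_) ((mul_le_mul' h1 (ENNReal.rpow_le_rpow h2 hq1.le)).trans hsup)
    rw [ENNReal.mul_rpow_of_nonneg _ _ hq1.le, ← mul_assoc, ← ENNReal.rpow_mul]
    have he : 1 / (1 - q) * (q - 1) = -1 := by
      have : 1 - q ≠ 0 := by linarith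
      field_simp
      ring
    rw [he, ENNReal.ofReal_rpow_of_pos (by positivity), ← ENNReal.ofReal_mul hlam.le]
    congr 2
    rw [Real.rpow_neg_one]
    field_simp
  have h4 : ρ ^ (q - 1) ≤ ENNReal.ofReal α ^ (q - 1) := by
    calc ρ ^ (q - 1) = ENNReal.ofReal β * (ENNReal.ofReal (1 / β) * ρ ^ (q - 1)) := by
          rw [← mul_assoc, ← ENNReal.ofReal_mul hβ.le, mul_one_div_cancel hβ.ne',
            ENNReal.ofReal_one, one_mul]
      _ ≤ ENNReal.ofReal β * ENNReal.ofReal M := by gcongr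
      _ = ENNReal.ofReal (β * M) := (ENNReal.ofReal_mul hβ.le).symm
      _ ≤ ENNReal.ofReal (α ^ (q - 1)) := by
          refine ENNReal.ofReal_le_ofReal ?_
          have : β ≤ α ^ (q - 1) / (M + 1) := min_le_right _ _
          rw [le_div_iff₀ (by positivity)] at this
          linarith
      _ = _ := (ENNReal.ofReal_rpow_of_pos hα).symm
  have h5 : ρ ≤ ENNReal.ofReal α := (ENNReal.rpow_le_rpow_iff hq1).1 h4
  rwa [hρ, ENNReal.div_le_iff hRp0 hRp1] at h5

theorem hasLowerBound_of_A1Bound {n : ℕ} {p γ : ℝ} (hγ₁ : γ < 1) {w : SpaceTime n → ℝ}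
    {C : ℝ} (hC : 0 < C) (hA : A1Bound p γ w C) (α : ℝ) :
    ∃ β, 0 < β ∧ β ≤ 1 ∧ HasLowerBound p γ w α β := by
  refine ⟨min 1 (1 / (2 * C)), lt_min one_pos (by positivity), min_le_left _ _, ?_⟩
  set β : ℝ := min 1 (1 / (2 * C)) with hβ
  intro x t L lam hL hlam havg
  have hvol : 0 < (2 * L) ^ n * ((1 - γ) * L ^ p) := by
    have : 0 < 1 - γ := by linarith
    positivity
  have h1 : ENNReal.ofReal lam ≤
      ⨍⁻ z in rectLower p γ x t L, ENNReal.ofReal (w z) ∂volume := by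
    rw [setLAverage_eq, ENNReal.le_div_iff_mul_le]
    · exact havg
    · left; rw [volume_rectLower p γ x t hL.le]; exact (ENNReal.ofReal_pos.2 hvol).ne'
    · left; rw [volume_rectLower p γ x t hL.le]; exact ENNReal.ofReal_ne_top
  have h2 := h1.trans (hA x t L hL)
  have h3 : ∀ᵐ z ∂volume.restrict (rectUpper p γ x t L), β * lam < w z := by
    filter_upwards [ae_essInf_le (f := fun z => ENNReal.ofReal (w z))
      (μ := volume.restrict (rectUpper p γ x t L))] with z hz
    have h4 : ENNReal.ofReal lam ≤ ENNReal.ofReal (C * w z) := by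
      rw [ENNReal.ofReal_mul hC.le]
      exact h2.trans (mul_le_mul' le_rfl hz)
    have h5 : lam ≤ C * w z := by
      by_contra! h
      exact absurd h4 (not_le.2 ((ENNReal.ofReal_lt_ofReal_iff hlam).2 h))
    have h6 : β ≤ 1 / (2 * C) := min_le_right _ _
    calc β * lam ≤ 1 / (2 * C) * lam := by gcongr
      _ < 1 / C * lam := by gcongr; linarith
      _ ≤ 1 / C * (C * w z) := by gcongr
      _ = w z := by field_simp
  have h7 : volume (rectUpper p γ x t L ∩ {z | w z ≤ β * lam}) = 0 := by
    rw [ae_restrict_iff' (measurableSet_rectUpper p γ x t hL.le), ae_iff] at h3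
    refine measure_mono_null (fun z hz => ?_) h3
    simp only [mem_ofPred_eq, not_forall, not_lt]
    exact ⟨hz.1, hz.2⟩
  rw [h7]
  exact zero_le

theorem MemParabolicA.exists_hasLowerBound {n : ℕ} {p q γ : ℝ} (hγ₁ : γ < 1)
    {w : SpaceTime n → ℝ} (hw : Measurable w) (hA : MemParabolicA p q γ w) {α : ℝ} (hα : 0 < α) :
    ∃ β, 0 < β ∧ β ≤ 1 ∧ HasLowerBound p γ w α β := by
  rcases hA.2 with ⟨hq, h⟩ | ⟨-, C, hC, h⟩
  · exact hasLowerBound_of_aqConst hq hγ₁ hw h hα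
  · exact hasLowerBound_of_A1Bound hγ₁ hC h α

theorem HasLowerBound.le_volume_superlevel {n : ℕ} {p γ α β : ℝ} {w : SpaceTime n → ℝ}
    (hα : 0 ≤ α) (hP : HasLowerBound p γ w α β) {x : Fin n → ℝ} {t L lam : ℝ}
    {B S : Set (SpaceTime n)} (hL : 0 < L) (hB : B ⊆ rectLower p γ x t L)
    (hS : S ⊆ rectUpper p γ x t L)
    (hvol : ENNReal.ofReal (2 * α) * volume (rectUpper p γ x t L) ≤ volume S) (hlam : 0 < lam)
    (havg : ENNReal.ofReal lam * volume (rectLower p γ x t L) ≤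
      ∫⁻ z in B, ENNReal.ofReal (w z)) :
    ENNReal.ofReal α * volume (rectUpper p γ x t L) ≤ volume (S ∩ {z | β * lam < w z}) := by
  have h1 := hP x t L lam hL hlam (havg.trans (lintegral_mono_set hB))
  have h2 : volume S ≤ volume (S ∩ {z | β * lam < w z}) +
      volume (rectUpper p γ x t L ∩ {z | w z ≤ β * lam}) := by
    refine (measure_mono fun z hz => ?_).trans (measure_union_le _ _)
    rcases lt_or_ge (β * lam) (w z) with h | h
    · exact Or.inl ⟨hz, h⟩
    · exact Or.inr ⟨hS hz, h⟩
  have h3 := hvol.trans (h2.trans (add_le_add le_rfl h1))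
  rw [two_mul, ENNReal.ofReal_add hα hα, add_mul] at h3
  refine (ENNReal.add_le_add_iff_right ?_).1 h3
  rw [volume_rectUpper p γ x t hL.le]
  exact ENNReal.mul_ne_top ENNReal.ofReal_ne_top ENNReal.ofReal_ne_top

theorem HasLowerBound.exists_hasDenseSuperlevels {n : ℕ} {p γ β : ℝ} (hp : 1 < p) (hγ₀ : 0 < γ)
    (hγ₁ : γ < 1) {w : SpaceTime n → ℝ} (hβ : 0 < β) (hβ1 : β ≤ 1)
    (hP : HasLowerBound p γ w (1 / 2) β) :
    ∃ K β', 1 ≤ K ∧ 0 < β' ∧ β' ≤ 1 ∧ HasDenseSuperlevels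
      (volume : Measure (ParabolicSpace n p hp)) w K 1 β' := by
  have hp0 : 0 < p := by linarith
  have hδ : 0 < 1 - γ := by linarith
  set a : ℝ := 4 / (1 - γ) with ha
  have haδ : (1 - γ) * a = 4 := by rw [ha]; field_simp
  have ha4 : 4 ≤ a := by rw [ha, le_div_iff₀ hδ]; linarith
  have ha0 : 0 < a := by linarith
  set k : ℝ := a ^ p⁻¹ with hk_def
  have hk1 : 1 ≤ k := Real.one_le_rpow (by linarith) (by positivity)
  have hk0 : 0 < k := by linarith
  have hkp : k ^ p = a := Real.rpow_inv_rpow ha0.le hp0.ne'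
  set K : ℝ := (2 * a) ^ p⁻¹ with hK_def
  have hkK : k ≤ K := Real.rpow_le_rpow ha0.le (by linarith) (by positivity)
  have hKp : K ^ p = 2 * a := Real.rpow_inv_rpow (by linarith) hp0.ne'
  have hK0 : 0 < K := by linarith
  have hkn : (1 : ℝ) ≤ k ^ n := one_le_pow₀ hk1
  refine ⟨K, β / (2 * k ^ n), hk1.trans hkK, by positivity, ?_, ?_⟩
  · rw [div_le_one (by positivity)]; linarith
  intro z r lam hr hlam havg
  have hrp : 0 < r ^ p := Real.rpow_pos_of_pos hr p
  have hL : 0 < k * r := by positivity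
  have hLp : (k * r) ^ p = a * r ^ p := by rw [Real.mul_rpow hk0.le hr.le, hkp]
  set t : ℝ := z.2 + (1 + γ) / 2 * (a * r ^ p) with ht
  have hδr : (1 - γ) * (a * r ^ p) = 4 * r ^ p := by rw [← mul_assoc, haδ]
  have hγr : 0 < γ * (a * r ^ p) := by positivity
  set Bz : Set (SpaceTime n) := closedBall (α := ParabolicSpace n p hp) z r with hBz
  have hball : volume Bz =
      ENNReal.ofReal ((2 * r) ^ n * (2 * r ^ p)) := by
    refine (ParabolicSpace.hasBallMeasure z r hr).trans ?_
    rw [Real.rpow_add hr, Real.rpow_natCast]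
    congr 1; ring
  have hlow : volume (rectLower p γ z.1 t (k * r)) =
      ENNReal.ofReal (2 * k ^ n) * volume Bz := by
    rw [hball, volume_rectLower p γ _ _ hL.le, hLp, hδr, ← ENNReal.ofReal_mul (by positivity)]
    congr 1; ring
  have hup : volume (rectUpper p γ z.1 t (k * r)) =
      ENNReal.ofReal (2 * k ^ n) * volume Bz := by
    rw [← hlow, volume_rectLower p γ _ _ hL.le, volume_rectUpper p γ _ _ hL.le]
  have h := hP.le_volume_superlevel (by norm_num) (x := z.1) (t := t) (L := k * r)
    (lam := lam / (2 * k ^ n)) (B := Bz) (S := rectUpper p γ z.1 t (k * r)) hL ?_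
    Subset.rfl (by norm_num) (by positivity) ?_
  · change ENNReal.ofReal 1 * volume Bz ≤ volume (_ ∩ {y : SpaceTime n | _ < w y})
    calc ENNReal.ofReal 1 * volume Bz
        ≤ ENNReal.ofReal (1 / 2) * volume (rectUpper p γ z.1 t (k * r)) := by
          rw [hup, ← mul_assoc, ← ENNReal.ofReal_mul (by norm_num)]
          gcongr
          linarith
      _ ≤ _ := h
      _ ≤ _ := by
          refine measure_mono ?_
          rintro y ⟨⟨hy1, hy2, hy3⟩, hy4⟩
          refine ⟨?_, ?_⟩
          · rw [ParabolicSpace.closedBall_eq z (by positivity)]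
            have hmul : (K * r) ^ p = 2 * a * r ^ p := by rw [Real.mul_rpow hK0.le hr.le, hKp]
            rw [hLp] at hy2 hy3
            refine ⟨fun i => (hy1 i).trans (by gcongr), ?_, ?_⟩
            · rw [hmul]; nlinarith
            · rw [hmul]; nlinarith
          · change β / (2 * k ^ n) * lam < w y
            rwa [div_mul_eq_mul_div, ← mul_div_assoc']
  · rw [hBz, ParabolicSpace.closedBall_eq z hr.le]
    rintro y ⟨hy1, hy2, hy3⟩
    refine ⟨fun i => (hy1 i).trans (by nlinarith), ?_, ?_⟩
    · rw [hLp]; nlinarith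
    · rw [hLp]; nlinarith
  · rw [hlow, ← mul_assoc, ← ENNReal.ofReal_mul (by positivity)]
    refine le_trans (le_of_eq ?_) havg.le
    congr 2
    field_simp

/-- A small ball centred in the lower half of a parabolic rectangle lies in the lower part of a
parabolic rectangle whose upper part meets the upper half of the original rectangle in a large
set. -/
theorem exists_rect_of_mem_rectLower {n : ℕ} {p γ : ℝ} (hp : 1 < p) (hγ₀ : 0 < γ) (hγ₁ : γ < 1)
    {x : Fin n → ℝ} {t L : ℝ} (hL : 0 < L) (z : ParabolicSpace n p hp)
    (hz : z ∈ rectLower p 0 x t L) :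
    ∃ (τ l : ℝ) (S : Set (SpaceTime n)), 0 < l ∧
      closedBall (α := ParabolicSpace n p hp) z (2 * ((1 - γ) / 48 * L)) ⊆
        rectLower p γ z.1 τ l ∧
      MeasurableSet S ∧ S ⊆ rectUpper p γ z.1 τ l ∧ S ⊆ rectUpper p 0 x t L ∧
      ENNReal.ofReal (2 * ((1 / 2) ^ n / 10)) * volume (rectUpper p γ z.1 τ l) ≤ volume S := by
  have hp0 : 0 < p := by linarith
  have hδ : 0 < 1 - γ := by linarith
  set α : ℝ := (1 / 2) ^ n / 10 with hα_def
  have hα : 0 < α := by positivity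
  obtain ⟨hz1, hz2, hz3⟩ := hz
  have hLp : 0 < L ^ p := Real.rpow_pos_of_pos hL p
  set d : ℝ := t - z.2 with hd
  have hd0 : 0 < d := by linarith
  have hdL : d < L ^ p := by linarith
  set m : ℝ := 2 / 3 * d + L ^ p / 6 with hm
  have hm0 : 0 < m := by positivity
  have hmL : L ^ p / 6 ≤ m := by linarith
  have hmU : m ≤ 5 / 6 * L ^ p := by linarith
  set l : ℝ := m ^ p⁻¹ with hl
  have hl0 : 0 < l := Real.rpow_pos_of_pos hm0 _
  have hlp : l ^ p = m := Real.rpow_inv_rpow hm0.le hp0.ne'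
  have hlL : l ≤ L := by
    rw [← Real.rpow_le_rpow_iff hl0.le hL.le hp0, hlp]
    linarith
  have hLl : L / 6 ≤ l := by
    rw [← Real.rpow_le_rpow_iff (by positivity) hl0.le hp0, hlp,
      Real.div_rpow hL.le (by norm_num)]
    refine le_trans ?_ hmL
    gcongr
    exact Real.self_le_rpow_of_one_le (by norm_num) hp.le
  set ρ : ℝ := 2 * ((1 - γ) / 48 * L) with hρ
  have hρ0 : 0 < ρ := by positivity
  have hρp : ρ ^ p ≤ (1 - γ) / 24 * L ^ p := by
    have h1 : ρ = (1 - γ) / 24 * L := by rw [hρ]; ring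
    rw [h1, Real.mul_rpow (by positivity) hL.le]
    gcongr
    exact Real.rpow_le_self_of_le_one (by positivity) (by linarith) hp.le
  have hρl : ρ ≤ l := by
    refine le_trans ?_ hLl
    rw [hρ]; nlinarith
  set τ : ℝ := z.2 + m * (1 + γ) / 2 with hτ
  have hδm : (1 - γ) * (L ^ p / 6) ≤ (1 - γ) * m := mul_le_mul_of_nonneg_left hmL hδ.le
  have hδL : 0 < (1 - γ) * L ^ p := by positivity
  set B : Set (SpaceTime n) := closedBall (α := ParabolicSpace n p hp) z ρ with hB
  have hBsub : B ⊆ rectLower p γ z.1 τ l := by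
    rw [hB, ParabolicSpace.closedBall_eq z hρ0.le]
    rintro y ⟨hy1, hy2, hy3⟩
    refine ⟨fun i => (hy1 i).trans hρl, ?_, ?_⟩
    · rw [hlp]; linarith
    · rw [hlp]; linarith
  set y₀ : Fin n → ℝ := fun i => z.1 i - l / (2 * L) * (z.1 i - x i) with hy₀
  set S : Set (SpaceTime n) :=
    spaceCube y₀ (l / 2) ×ˢ Ioo (max (τ + γ * m) t) (min (τ + m) (t + L ^ p)) with hS
  have hratio : l / (2 * L) * L = l / 2 := by field_simp
  have hratio0 : 0 < l / (2 * L) := by positivity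
  have hratio1 : l / (2 * L) ≤ 1 := by rw [div_le_one (by positivity)]; linarith
  have hSup : S ⊆ rectUpper p γ z.1 τ l := by
    refine prod_mono (spaceCube_subset_spaceCube fun i => ?_) ?_
    · have h1 : y₀ i - z.1 i = -(l / (2 * L) * (z.1 i - x i)) := by rw [hy₀]; ring
      rw [h1, abs_neg, abs_mul, abs_of_pos hratio0]
      nlinarith [hz1 i]
    · rw [hlp]
      exact Ioo_subset_Ioo (le_max_left _ _) (min_le_left _ _)
  have hSR : S ⊆ rectUpper p 0 x t L := by
    refine prod_mono (spaceCube_subset_spaceCube fun i => ?_) ?_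
    · have h1 : y₀ i - x i = (1 - l / (2 * L)) * (z.1 i - x i) := by rw [hy₀]; ring
      rw [h1, abs_mul, abs_of_nonneg (by linarith)]
      nlinarith [hz1 i]
    · rw [zero_mul, add_zero]
      exact Ioo_subset_Ioo (le_max_right _ _) (min_le_right _ _)
  have hlen : (1 - γ) * (L ^ p / 6) ≤ min (τ + m) (t + L ^ p) - max (τ + γ * m) t := by
    have hγm : 0 < γ * m := by positivity
    have hγm1 : γ * m < m := by nlinarith
    have hγL : (1 - γ) * (L ^ p / 6) ≤ L ^ p / 6 := by nlinarith
    rw [le_sub_iff_add_le, le_min_iff, ← le_sub_iff_add_le', ← le_sub_iff_add_le', max_le_iff,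
      max_le_iff]
    refine ⟨⟨?_, ?_⟩, ?_, ?_⟩ <;> linarith
  have hSvol : ENNReal.ofReal (2 * α) * volume (rectUpper p γ z.1 τ l) ≤ volume S := by
    rw [volume_rectUpper p γ _ _ hl0.le, hS, volume_spaceCube_prod_Ioo _ (by positivity), hlp,
      ← ENNReal.ofReal_mul (by positivity)]
    refine ENNReal.ofReal_le_ofReal ?_
    calc 2 * α * ((2 * l) ^ n * ((1 - γ) * m))
        = (2 * (l / 2)) ^ n * ((1 - γ) * (m / 5)) := by
          rw [hα_def, show 2 * (l / 2) = 1 / 2 * (2 * l) by ring, mul_pow (1 / 2)]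
          ring
      _ ≤ (2 * (l / 2)) ^ n * ((1 - γ) * (L ^ p / 6)) := by
          gcongr ?_ * (_ * ?_)
          linarith
      _ ≤ _ := by gcongr
  exact ⟨τ, l, S, hl0, hBsub, (measurableSet_spaceCube _ (by positivity)).prod measurableSet_Ioo,
    hSup, hSR, hSvol⟩

/-- The mass of a small ball centred in the lower half of a parabolic rectangle is controlled by
the mass of the upper half. -/
theorem HasLowerBound.exists_lintegral_closedBall_le {n : ℕ} {p γ β : ℝ} (hp : 1 < p)
    (hγ₀ : 0 < γ) (hγ₁ : γ < 1) {w : SpaceTime n → ℝ} (hwm : Measurable w)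
    (hw : LocallyIntegrable w volume) (hβ : 0 < β) (hP : HasLowerBound p γ w ((1 / 2) ^ n / 10) β) :
    ∃ κ C : ℝ, 0 < κ ∧ κ ≤ 1 ∧ 0 < C ∧ ∀ (x : Fin n → ℝ) (t L : ℝ), 0 < L →
      ∀ z : ParabolicSpace n p hp, z ∈ rectLower p 0 x t L →
        ∫⁻ y in (closedBall z (2 * (κ * L)) : Set (ParabolicSpace n p hp)), ENNReal.ofReal (w y)
            ∂(volume : Measure (SpaceTime n)) ≤
          ENNReal.ofReal C * ∫⁻ y in rectUpper p 0 x t L, ENNReal.ofReal (w y) := by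
  have hp0 : 0 < p := by linarith
  have hδ : 0 < 1 - γ := by linarith
  set α : ℝ := (1 / 2) ^ n / 10 with hα_def
  have hα : 0 < α := by positivity
  refine ⟨(1 - γ) / 48, 1 / (α * β), by positivity, by linarith, by positivity, ?_⟩
  intro x t L hL z hz
  obtain ⟨τ, l, S, hl0, hBsub, hSm, hSup, hSR, hSvol⟩ :=
    exists_rect_of_mem_rectLower hp hγ₀ hγ₁ hL z hz
  set ρ : ℝ := 2 * ((1 - γ) / 48 * L) with hρ
  have hρ0 : 0 < ρ := by positivity
  set B : Set (SpaceTime n) := closedBall (α := ParabolicSpace n p hp) z ρ with hB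
  set I : ℝ≥0∞ := ∫⁻ y in B, ENNReal.ofReal (w y) ∂(volume : Measure (SpaceTime n)) with hI
  have hItop : I ≠ ∞ := ParabolicSpace.lintegral_closedBall_ne_top hw z hρ0.le
  rcases eq_or_ne I 0 with hI0 | hI0
  · rw [hI0]; exact zero_le
  set v : ℝ := (2 * l) ^ n * ((1 - γ) * l ^ p) with hv
  have hv0 : 0 < v := by have := Real.rpow_pos_of_pos hl0 p; positivity
  have hIr : 0 < I.toReal := ENNReal.toReal_pos hI0 hItop
  have h := hP.le_volume_superlevel hα.le hl0 hBsub hSup hSvol (lam := I.toReal / v)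
    (by positivity) (by
      rw [volume_rectLower p γ _ _ hl0.le, ← hv, ← ENNReal.ofReal_mul (by positivity),
        div_mul_cancel₀ _ hv0.ne', ENNReal.ofReal_toReal hItop])
  rw [volume_rectUpper p γ _ _ hl0.le, ← hv] at h
  have h2 : ENNReal.ofReal (β * (I.toReal / v)) * (ENNReal.ofReal α * ENNReal.ofReal v) ≤
      ∫⁻ y in rectUpper p 0 x t L, ENNReal.ofReal (w y) := by
    calc _ ≤ ENNReal.ofReal (β * (I.toReal / v)) *
          volume (S ∩ {y | β * (I.toReal / v) < w y}) := by gcongr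
      _ = ∫⁻ y in S ∩ {y | β * (I.toReal / v) < w y}, ENNReal.ofReal (β * (I.toReal / v)) := by
          rw [lintegral_const, Measure.restrict_apply_univ]
      _ ≤ ∫⁻ y in S ∩ {y | β * (I.toReal / v) < w y}, ENNReal.ofReal (w y) := by
          exact setLIntegral_mono' (hSm.inter (measurableSet_lt measurable_const hwm))
            fun y hy => ENNReal.ofReal_le_ofReal (le_of_lt hy.2)
      _ ≤ _ := lintegral_mono_set (inter_subset_left.trans hSR)
  calc I = ENNReal.ofReal (1 / (α * β)) *
        (ENNReal.ofReal (β * (I.toReal / v)) * (ENNReal.ofReal α * ENNReal.ofReal v)) := by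
        rw [← ENNReal.ofReal_mul hα.le, ← ENNReal.ofReal_mul (by positivity),
          ← ENNReal.ofReal_mul (by positivity)]
        conv_lhs => rw [← ENNReal.ofReal_toReal hItop]
        congr 1
        field_simp
    _ ≤ _ := by gcongr

theorem thickening_subset_closedBall {α : Type*} [PseudoMetricSpace α] {A : Set α} {z : α}
    {δ r s : ℝ} (hA : A ⊆ closedBall z r) (h : δ + r ≤ s) : thickening δ A ⊆ closedBall z s := by
  intro y hy
  obtain ⟨a, ha, hya⟩ := mem_thickening_iff.1 hy
  have h1 := mem_closedBall.1 (hA ha)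
  exact mem_closedBall.2 (by linarith [dist_triangle y a z])

theorem MemParabolicA.congr_ae {n : ℕ} {p q γ : ℝ} {w v : SpaceTime n → ℝ} (h : w =ᵐ[volume] v)
    (hv : ∀ z, 0 ≤ v z) (hw : MemParabolicA p q γ w) : MemParabolicA p q γ v := by
  have hset : ∀ s : Set (SpaceTime n), w =ᵐ[volume.restrict s] v := fun s => ae_restrict_of_ae h
  have hint : ∀ s : Set (SpaceTime n), ⨍⁻ z in s, ENNReal.ofReal (w z) ∂volume =
      ⨍⁻ z in s, ENNReal.ofReal (v z) ∂volume := fun s => by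
    refine laverage_congr ?_
    filter_upwards [hset s] with z hz
    rw [hz]
  have hpow : ∀ (s : Set (SpaceTime n)) (e : ℝ), ⨍⁻ z in s, ENNReal.ofReal (w z) ^ e ∂volume =
      ⨍⁻ z in s, ENNReal.ofReal (v z) ^ e ∂volume := fun s e => by
    refine laverage_congr ?_
    filter_upwards [hset s] with z hz
    rw [hz]
  refine ⟨⟨hv, hw.1.locallyIntegrable.congr h⟩, hw.2.imp ?_ ?_⟩
  · rintro ⟨hq, hA⟩
    refine ⟨hq, ?_⟩
    unfold aqConst at hA ⊢
    simpa only [hint, hpow] using hA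
  · rintro ⟨hq, C, hC, hA⟩
    refine ⟨hq, C, hC, fun x t L hL => ?_⟩
    rw [← hint]
    refine (hA x t L hL).trans (le_of_eq ?_)
    congr 1
    refine essInf_congr_ae ?_
    filter_upwards [hset (rectUpper p γ x t L)] with z hz
    rw [hz]

/-- The reverse Hölder inequality for measurable parabolic Muckenhoupt weights. -/
theorem MemParabolicA.exists_reverse_holder_of_measurable {n : ℕ} {p q γ : ℝ} (hp : 1 < p)
    (hγ₀ : 0 < γ) (hγ₁ : γ < 1) {w : SpaceTime n → ℝ} (hwm : Measurable w)
    (hw : MemParabolicA p q γ w) :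
    ∃ ε c : ℝ, 0 < ε ∧ 0 < c ∧
      ∀ (x : Fin n → ℝ) (t L : ℝ), 0 < L →
        (⨍⁻ z in rectLower p 0 x t L, ENNReal.ofReal (w z) ^ (1 + ε) ∂volume) ^ (1 / (1 + ε)) ≤
          ENNReal.ofReal c * ⨍⁻ z in rectUpper p 0 x t L, ENNReal.ofReal (w z) ∂volume := by
  have hp0 : 0 < p := by linarith
  have hw0 := hw.1.nonneg
  have hwl := hw.1.locallyIntegrable
  obtain ⟨β₁, hβ₁, hβ₁', hP₁⟩ := hw.exists_hasLowerBound hγ₁ hwm (α := 1 / 2) (by norm_num)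
  obtain ⟨K, β', hK, hβ', hβ'', hd⟩ := hP₁.exists_hasDenseSuperlevels hp hγ₀ hγ₁ hβ₁ hβ₁'
  obtain ⟨β₂, hβ₂, -, hP₂⟩ := hw.exists_hasLowerBound hγ₁ hwm (α := (1 / 2) ^ n / 10)
    (by positivity)
  obtain ⟨κ, C₁, hκ, hκ1, hC₁, hjump⟩ :=
    hP₂.exists_lintegral_closedBall_le hp hγ₀ hγ₁ hwm hwl hβ₂
  obtain ⟨ε, C₂, hε, hC₂, hG⟩ :=
    (ParabolicSpace.hasBallMeasure (n := n) (hp := hp)).exists_lintegral_rpow_le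
    (by positivity) (by positivity) hwm hw0 hK one_pos hβ' hβ'' hd
  set D : ℝ := n + p with hD
  set C₃ : ℝ := C₁ / (2 * κ ^ D) with hC₃_def
  have hC₃ : 0 < C₃ := by positivity
  set C₄ : ℝ := (C₂ * (2 * 2 ^ D)) ^ (1 / (1 + ε)) with hC₄_def
  have hC₄ : 0 < C₄ := by positivity
  refine ⟨ε, C₄ * C₃, hε, by positivity, ?_⟩
  intro x t L hL
  have hLp : 0 < L ^ p := Real.rpow_pos_of_pos hL p
  set A : Set (SpaceTime n) := rectLower p 0 x t L with hA
  set R : Set (SpaceTime n) := rectUpper p 0 x t L with hR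
  set v : ℝ := (2 * L) ^ n * L ^ p with hv_def
  have hv : 0 < v := by positivity
  have hvD : 2 ^ (n + 1) * L ^ D = 2 * v := by
    rw [hv_def, hD, Real.rpow_add hL, Real.rpow_natCast]; ring
  have hAv : volume A = ENNReal.ofReal v := by
    rw [hA, volume_rectLower p 0 x t hL.le, sub_zero, one_mul]
  have hRv : volume R = ENNReal.ofReal v := by
    rw [hR, volume_rectUpper p 0 x t hL.le, sub_zero, one_mul]
  let z₀ : ParabolicSpace n p hp := (x, t)
  have hAR : A ∪ R ⊆ closedBall (α := ParabolicSpace n p hp) z₀ L := by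
    rw [ParabolicSpace.closedBall_eq z₀ hL.le]
    rintro y (⟨h1, h2, h3⟩ | ⟨h1, h2, h3⟩)
    · exact ⟨h1, h2.le, by change y.2 ≤ t + L ^ p; linarith⟩
    · exact ⟨h1, by change t - L ^ p ≤ y.2; linarith, h3.le⟩
  set J : ℝ≥0∞ := ∫⁻ y in R, ENNReal.ofReal (w y) with hJ
  have hJtop : J ≠ ∞ := ne_top_of_le_ne_top
    (ParabolicSpace.lintegral_closedBall_ne_top hwl z₀ hL.le)
    (lintegral_mono_set (subset_union_right.trans hAR))
  have hJr : J = ENNReal.ofReal J.toReal := (ENNReal.ofReal_toReal hJtop).symm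
  have hκL : 0 < κ * L := by positivity
  set T : Set (SpaceTime n) := thickening (α := ParabolicSpace n p hp) (κ * L) A with hT
  have hTball : T ⊆ closedBall (α := ParabolicSpace n p hp) z₀ (2 * L) := by
    refine thickening_subset_closedBall (α := ParabolicSpace n p hp)
      (subset_union_left.trans hAR) ?_
    nlinarith
  have hTfin : ∫⁻ y in T, ENNReal.ofReal (w y) ≠ ∞ := ne_top_of_le_ne_top
    (ParabolicSpace.lintegral_closedBall_ne_top hwl z₀ (by positivity))
    (lintegral_mono_set hTball)
  have hTvol : volume T ≤ ENNReal.ofReal (2 * 2 ^ D * v) := by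
    refine (measure_mono hTball).trans (le_of_eq ?_)
    refine (ParabolicSpace.hasBallMeasure z₀ (2 * L) (by positivity)).trans ?_
    rw [Real.mul_rpow (by norm_num) hL.le]
    congr 1
    calc _ = 2 ^ D * (2 ^ (n + 1) * L ^ D) := by rw [hD]; ring
      _ = _ := by rw [hvD]; ring
  have hmain : ∀ δ : ℝ, 0 < δ →
      (⨍⁻ z in A, ENNReal.ofReal (w z) ^ (1 + ε) ∂volume) ^ (1 / (1 + ε)) ≤
        ENNReal.ofReal (C₄ * (C₃ * (J.toReal / v) + δ)) := by
    intro δ hδ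
    have hlam : 0 < C₃ * (J.toReal / v) + δ := by
      have : 0 ≤ J.toReal := ENNReal.toReal_nonneg
      positivity
    have h1 := hG A (κ * L) (C₃ * (J.toReal / v) + δ) hκL hlam hTfin ?_
    · have h2 : ⨍⁻ z in A, ENNReal.ofReal (w z) ^ (1 + ε) ∂volume ≤
          ENNReal.ofReal (C₂ * (2 * 2 ^ D) * (C₃ * (J.toReal / v) + δ) ^ (1 + ε)) := by
        rw [setLAverage_eq, hAv]
        refine ENNReal.div_le_of_le_mul ?_
        refine h1.trans ((mul_le_mul' le_rfl hTvol).trans (le_of_eq ?_))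
        rw [← ENNReal.ofReal_mul (by positivity), ← ENNReal.ofReal_mul (by positivity)]
        congr 1; ring
      refine (ENNReal.rpow_le_rpow h2 (by positivity)).trans (le_of_eq ?_)
      rw [ENNReal.ofReal_rpow_of_nonneg (by positivity) (by positivity),
        Real.mul_rpow (by positivity) (by positivity), ← Real.rpow_mul hlam.le,
        mul_one_div_cancel (by positivity), Real.rpow_one]
    · intro z hz
      obtain ⟨z', hz', hzz⟩ := mem_thickening_iff.1 hz
      have hsub : closedBall z (κ * L) ⊆ closedBall z' (2 * (κ * L)) :=
        closedBall_subset_closedBall' (by linarith)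
      refine (lintegral_mono_set hsub).trans ((hjump x t L hL z' hz').trans ?_)
      rw [ParabolicSpace.hasBallMeasure z (κ * L) hκL, Real.mul_rpow hκ.le hL.le,
        ← ENNReal.ofReal_mul hlam.le]
      change ENNReal.ofReal C₁ * J ≤ _
      conv_lhs => rw [hJr, ← ENNReal.ofReal_mul hC₁.le]
      refine ENNReal.ofReal_le_ofReal ?_
      calc C₁ * J.toReal = C₃ * (J.toReal / v) * (κ ^ D * (2 * v)) := by
            rw [hC₃_def]; field_simp
        _ ≤ (C₃ * (J.toReal / v) + δ) * (κ ^ D * (2 * v)) := by gcongr; linarith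
        _ = _ := by rw [← hvD, ← hD]; ring
  have havg : ENNReal.ofReal (C₄ * C₃) * ⨍⁻ z in R, ENNReal.ofReal (w z) ∂volume =
      ENNReal.ofReal (C₄ * (C₃ * (J.toReal / v))) := by
    conv_lhs => rw [setLAverage_eq, hRv, ← hJ, hJr]
    rw [← ENNReal.ofReal_div_of_pos hv, ← ENNReal.ofReal_mul (by positivity), mul_assoc]
  rw [havg]
  refine ENNReal.le_of_forall_pos_le_add fun δ hδ _ => ?_
  refine (hmain (δ / C₄) (by positivity)).trans (le_of_eq ?_)
  have hJ0 : 0 ≤ J.toReal := ENNReal.toReal_nonneg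
  rw [mul_add, mul_div_cancel₀ _ hC₄.ne', ENNReal.ofReal_add (by positivity) (by positivity),
    ENNReal.ofReal_coe_nnreal]

theorem mainTheorem7 {n : ℕ} (p q γ : ℝ) (hp : 1 < p) (hq : 1 ≤ q) (hγ₀ : 0 < γ) (hγ₁ : γ < 1)
    (w : SpaceTime n → ℝ) (hw : MemParabolicA p q γ w) :
    ∃ ε c : ℝ, 0 < ε ∧ 0 < c ∧
      ∀ (x : Fin n → ℝ) (t L : ℝ), 0 < L →
        (⨍⁻ z in rectLower p 0 x t L, ENNReal.ofReal (w z) ^ (1 + ε) ∂volume) ^ (1 / (1 + ε)) ≤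
          ENNReal.ofReal c * ⨍⁻ z in rectUpper p 0 x t L, ENNReal.ofReal (w z) ∂volume := by
  have hae := hw.1.locallyIntegrable.aestronglyMeasurable.aemeasurable
  set v : SpaceTime n → ℝ := fun z => max (hae.mk w z) 0 with hv
  have hvm : Measurable v := hae.measurable_mk.max measurable_const
  have hwv : w =ᵐ[volume] v := by
    filter_upwards [hae.ae_eq_mk] with z hz
    rw [hv]
    simp only [← hz, max_eq_left (hw.1.nonneg z)]
  have hvA := hw.congr_ae hwv fun z => le_max_right _ _
  obtain ⟨ε, c, hε, hc, h⟩ := hvA.exists_reverse_holder_of_measurable hp hγ₀ hγ₁ hvm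
  refine ⟨ε, c, hε, hc, fun x t L hL => ?_⟩
  have h1 : ∀ (s : Set (SpaceTime n)) (e : ℝ), ⨍⁻ z in s, ENNReal.ofReal (w z) ^ e ∂volume =
      ⨍⁻ z in s, ENNReal.ofReal (v z) ^ e ∂volume := fun s e => by
    refine laverage_congr ?_
    filter_upwards [ae_restrict_of_ae hwv] with z hz
    rw [hz]
  have h2 := h x t L hL
  have h3 := h1 (rectUpper p 0 x t L) 1
  simp only [ENNReal.rpow_one] at h3
  rw [h1, h3]
  exact h2
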